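/- Let $H$ be a separable infinite-dimensional real Hilbert space with norm $\|\cdot\|$, and let $A$ be a positive self-adjoint operator on $H$, with domain $D(A)$, whose inverse is compact. Let $(w_j)_{j\ge1}$ be an orthonormal basis of eigenvectors, $Aw_j=\lambda_jw_j$, with $0<\lambda_1\le\lambda_2\le\cdots$, and suppose that $\log n/\lambda_{n+1}\to0$ as $n\to\infty$. Let $D(A^{1/2})$ carry the norm $\|A^{1/2}u\|$, and let $F:D(A^{1/2})\to H$ be Lipschitz on bounded subsets of $D(A^{1/2})$. Suppose that $\frac{du}{dt}+Au=F(u)$ generates a semigroup $(S_t)_{t\ge0}$ on $D(A^{1/2})$; that is, for each $u_0\in D(A^{1/2})$ the function $u(t)=S_tu_0$ is continuous from $[0,\infty)$ into $D(A^{1/2})$ and $$u(t)=e^{-At}u_0+\int_0^te^{-A(t-s)}F(u(s))\,ds\qquad(t\ge0).$$ Let $\mathcal A$ be the global attractor of $(S_t)$: a compact subset of $D(A^{1/2})$ with $S_t\mathcal A=\mathcal A$ for all $t\ge0$ that attracts every bounded subset of $D(A^{1/2})$ uniformly. Suppose that $\mathcal A\subset D(A)$ and that there are constants $C>0$ and $M_1$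 with $$\|A(u-v)\|\le C\,\|u-v\|\,\log\frac{M_1^2}{\|u-v\|^2}\qquad\text{for all }u,v\in\mathcal A,\ u\ne v.$$ For a compact set $X\subset H$, $m\ge 0$ and $\epsilon>0$ let $\delta_m(X,\epsilon)$ be the smallest dimension of a finite-dimensional linear subspace $U\subset H$ for which there is an $m$-Lipschitz map $\varphi:U\to U^\perp$ with $\sup_{x\in X}\operatorname{dist}(x,\{u+\varphi(u):u\in U\})<\epsilon$, and let $$\operatorname{dev}_m(X)=\limsup_{\epsilon\to0}\frac{\log\delta_m(X,\epsilon)}{-\log\epsilon}$$ (with $\log 0$ read as $0$). Then the following hold. 1. $\operatorname{dev}_1(\mathcal A)=0$. 2. Suppose that $\mathcal A$ has finite (upper) box-counting dimension $d$ in $H$. Let $N>2d$ be an integer and $0<\theta<1-\frac{2d}{N}$. Then for a prevalent set of bounded linear maps $L:H\to\mathbb R^N$, $L$ is injective on $\mathcal A$ and there is a constant $C_L>0$ with $$\|x-y\|\le C_L\,|L(x)-L(y)|^{\theta}\qquad\text{for all }x,y\in\mathcal A.$$ 3. Consequently, if $d<\infty$, then for every $\theta\in(0,1)$ there is $N_0$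 such that, for every $N\ge N_0$, the conclusion of part 2 holds for this $\theta$ and $N$. Here a set $P$ of bounded linear maps $H\to\mathbb R^N$ is prevalent if it contains a Borel set $B$ (in the operator norm) for which there is a compactly supported Borel probability measure $\mu$ such that, for every bounded linear map $L_0:H\to\mathbb R^N$, $L+L_0\in B$ for $\mu$-almost every $L$. -/

import Mathlib

open Set Filter Topology MeasureTheory
open scoped NNReal ENNReal RealInnerProductSpace

noncomputable section

/-! ### Lipschitz deviation, box-counting dimension, prevalence -/

section General

variable {E : Type*} [NormedAddCommGroup E] [InnerProductSpace ℝ E]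

/-- The graph `{u + φ u : u ∈ U}` over a linear subspace `U` of a map `φ : U → Uᗮ`. -/
def graphOver (U : Submodule ℝ E) (φ : U → Uᗮ) : Set E :=
  range fun u : U => (u : E) + (φ u : E)

/-- `δ_m(X, ε)`: the smallest dimension of a finite-dimensional linear subspace `U` for which some
`m`-Lipschitz `φ : U → Uᗮ` satisfies `sup_{x ∈ X} dist(x, graph φ) < ε`. For compact `X` and
`ε > 0` such a subspace always exists. -/
def lipDelta (m : ℝ≥0) (X : Set E) (ε : ℝ) : ℕ :=
  sInf {k : ℕ | ∃ U : Submodule ℝ E, FiniteDimensional ℝ U ∧ Module.finrank ℝ U = k ∧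
    ∃ φ : U → Uᗮ, LipschitzWith m φ ∧
      (⨆ x ∈ X, Metric.infEDist x (graphOver U φ)) < ENNReal.ofReal ε}

/-- The `m`-Lipschitz deviation `limsup_{ε → 0⁺} log δ_m(X, ε) / (-log ε)` of a compact set `X`.
The quotient is nonnegative for `ε < 1`; where `δ_m(X, ε) = 0` (for example if `X` is one point)
the numerator is read as `0`. -/
def lipDev (m : ℝ≥0) (X : Set E) : ℝ≥0∞ :=
  limsup (fun ε : ℝ => ENNReal.ofReal (Real.log (lipDelta m X ε) / -Real.log ε)) (𝓝[>] 0)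

/-- The (upper) box-counting dimension `limsup_{ε → 0⁺} log N(X, ε) / (-log ε)` of a compact set
`X`, where `N(X, ε)` is the least number of closed `ε`-balls centred in `X` that cover `X`. -/
def boxDim (X : Set E) : ℝ≥0∞ :=
  limsup (fun ε : ℝ =>
    ENNReal.ofReal (Real.log (Metric.coveringNumber ε.toNNReal X).toNat / -Real.log ε)) (𝓝[>] 0)

end General

/-- Prevalence in the sense of Hunt, Sauer and Yorke: `P` contains a Borel set `B` for which there
is a compactly supported Borel probability measure `μ` such that almost every `x` lies in `B - v`,
for every translation vector `v`. -/
def IsPrevalent {V : Type*} [NormedAddCommGroup V] [MeasurableSpace V] [BorelSpace V]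
    (P : Set V) : Prop :=
  ∃ B ⊆ P, MeasurableSet B ∧ ∃ μ : Measure V, IsProbabilityMeasure μ ∧
    (∃ K : Set V, IsCompact K ∧ μ Kᶜ = 0) ∧ ∀ v : V, ∀ᵐ x ∂μ, x + v ∈ B

/-! ### The linear operator -/

section Operator

variable {H : Type*} [NormedAddCommGroup H] [InnerProductSpace ℝ H] [CompleteSpace H]

/-- A positive self-adjoint (densely defined, unbounded) operator with compact inverse. -/
structure IsPosSelfAdjointCompactInv (A : H →ₗ.[ℝ] H) : Prop where
  selfAdjoint : IsSelfAdjoint A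
  pos : ∀ x : A.domain, x ≠ 0 → 0 < ⟪A x, (x : H)⟫
  compact_inv : ∃ T : H →L[ℝ] H, IsCompactOperator T ∧
    (∀ y : H, ∃ h : T y ∈ A.domain, A ⟨T y, h⟩ = y) ∧ ∀ x : A.domain, T (A x) = x

/-- The orthonormal basis `w` consists of eigenvectors of `A`, with eigenvalues `lam` listed in
nondecreasing order; `lam j` is the `(j + 1)`-st eigenvalue. -/
structure IsEigenbasis (A : H →ₗ.[ℝ] H) (w : HilbertBasis ℕ ℝ H) (lam : ℕ → ℝ) : Prop where
  eigen : ∀ j, ∃ h : w j ∈ A.domain, A ⟨w j, h⟩ = lam j • w j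
  mono : Monotone lam

/-- The domain of the fractional power `A ^ α`. -/
def fracDomain (w : HilbertBasis ℕ ℝ H) (lam : ℕ → ℝ) (α : ℝ) : Set H :=
  {u | Summable fun j => (lam j ^ α * ⟪w j, u⟫) ^ 2}

/-- The fractional power `A ^ α u = ∑ⱼ λⱼ ^ α (u, wⱼ) wⱼ`, for `u` in its domain. -/
def fracPow (w : HilbertBasis ℕ ℝ H) (lam : ℕ → ℝ) (α : ℝ) (u : H) : H :=
  ∑' j, (lam j ^ α * ⟪w j, u⟫) • w j

/-- The semigroup `e^{-At} u = ∑ⱼ e^{-λⱼ t} (u, wⱼ) wⱼ`, for `t ≥ 0`. -/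
def expNeg (w : HilbertBasis ℕ ℝ H) (lam : ℕ → ℝ) (t : ℝ) (u : H) : H :=
  ∑' j, (Real.exp (-(lam j * t)) * ⟪w j, u⟫) • w j

/-! ### The equation `u' + A u = F u` with phase space `D(A ^ α)` and its global attractor

The norm of `D(A ^ α)` is `‖A ^ α u‖`. -/

/-- `F` is Lipschitz on bounded subsets of `D(A ^ α)`, as a map from `D(A ^ α)` to `H`. -/
def LocLipOn (w : HilbertBasis ℕ ℝ H) (lam : ℕ → ℝ) (α : ℝ) (F : H → H) : Prop :=
  ∀ R : ℝ, ∃ K : ℝ, ∀ u ∈ fracDomain w lam α, ∀ v ∈ fracDomain w lam α,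
    ‖fracPow w lam α u‖ ≤ R → ‖fracPow w lam α v‖ ≤ R →
      ‖F u - F v‖ ≤ K * ‖fracPow w lam α (u - v)‖

/-- `u` is a solution of `u' + A u = F u` on `[0, ∞)` with `u 0 = u₀`: it is continuous with values
in `D(A ^ α)` and satisfies the variation of constants formula. -/
def IsSolution (w : HilbertBasis ℕ ℝ H) (lam : ℕ → ℝ) (α : ℝ) (F : H → H) (u₀ : H)
    (u : ℝ → H) : Prop :=
  (∀ t, 0 ≤ t → u t ∈ fracDomain w lam α) ∧
  ContinuousOn (fun t => fracPow w lam α (u t)) (Ici 0) ∧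
  ∀ t, 0 ≤ t → u t = expNeg w lam t u₀ + ∫ s in (0 : ℝ)..t, expNeg w lam (t - s) (F (u s))

/-- `S t`, `t ≥ 0`, is the solution semigroup on `D(A ^ α)`: the trajectory `t ↦ S t u₀` is the
solution that starts at `u₀`. -/
def IsSolutionSemigroup (w : HilbertBasis ℕ ℝ H) (lam : ℕ → ℝ) (α : ℝ) (F : H → H)
    (S : ℝ → H → H) : Prop :=
  ∀ u₀ ∈ fracDomain w lam α, IsSolution w lam α F u₀ fun t => S t u₀

/-- `𝒜` is the global attractor of `S` in `D(A ^ α)`: compact and invariant, and it uniformly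
attracts every bounded set. Compactness is that of `D(A ^ α)`, on which `A ^ α` is an isometry
onto `H`. -/
structure IsGlobalAttractor (w : HilbertBasis ℕ ℝ H) (lam : ℕ → ℝ) (α : ℝ)
    (S : ℝ → H → H) (𝒜 : Set H) : Prop where
  subset : 𝒜 ⊆ fracDomain w lam α
  compact : IsCompact (fracPow w lam α '' 𝒜)
  invariant : ∀ t, 0 ≤ t → S t '' 𝒜 = 𝒜
  attracts : ∀ D ⊆ fracDomain w lam α, (∃ R : ℝ, ∀ u ∈ D, ‖fracPow w lam α u‖ ≤ R) →
    ∀ ε > 0, ∃ T : ℝ, 0 ≤ T ∧ ∀ t ≥ T, ∀ u ∈ D, ∃ a ∈ 𝒜, ‖fracPow w lam α (S t u - a)‖ < ε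

end Operator

/-- The bounded linear maps `L : H → ℝ^N` that are injective on `X` and whose inverse on `L X` is
Hölder continuous with exponent `θ`. -/
def holderEmbeddings {H : Type*} [NormedAddCommGroup H] [InnerProductSpace ℝ H] (X : Set H)
    (N : ℕ) (θ : ℝ) : Set (H →L[ℝ] EuclideanSpace ℝ (Fin N)) :=
  {L | InjOn L X ∧ ∃ C > 0, ∀ x ∈ X, ∀ y ∈ X, ‖x - y‖ ≤ C * ‖L x - L y‖ ^ θ}

end

noncomputable section

/-! ### Kirszbraun's extension theorem for finite sets -/

section Kirszbraun

variable {E G : Type*} [NormedAddCommGroup E] [InnerProductSpace ℝ E]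
  [NormedAddCommGroup G] [InnerProductSpace ℝ G]

/-! The logarithmic bound turns growth of the spectrum into control by few modes. For a difference z
of attractor points, either the first n modes of z dominate its tail, or `‖A z‖` is so large that z
must be tiny: ‖z‖ ≤ |M₁| exp(-λₙ₊₁/4C) (`norm_tail_le_or_norm_le_exp`). As log n = o(λₙ₊₁), at most
ε^(-η) modes exclude the second case for all ‖z‖ ≥ ε, for any η > 0 and small ε. This is
`HasDominantModes`, and both conclusions rest on it.

For the deviation, a separated net of the attractor is then a graph of a nonexpansive map over
finitely many points in the span of those modes. Kirszbraun's theorem extends the map to the whole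
span, so δ₁ grows more slowly than any power of 1/ε.

For the embedding, take L z = ∑ₖ (k+1)⁻²⟪wₖ, z⟫ωₖ with independent uniform ωₖ. A dominated z has a
mode k < n of size at least ‖z‖/2n, and the randomness of ωₖ alone makes ‖(L + v) z‖ ≤ δ improbable:
at most (4δn³/‖z‖)^N (`coeffMeasure_norm_le_of_dominant`). Subpolynomial n makes the loss n³
harmless. A union bound over about ρ^(-2d) pairs from a ρ-net, with ‖z‖ of order at least ρ^θ,
leaves a positive power of ρ exactly because N(1-θ) > 2d. Borel–Cantelli over dyadic ρ finishes the
proof. -/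

theorem sum_sum_mul_norm_sub_sq {ι : Type*} [Fintype ι] {l : ι → ℝ} (hl : ∑ i, l i = 1)
    (y : ι → G) :
    ∑ i, ∑ j, l i * l j * ‖y i - y j‖ ^ 2 =
      2 * (∑ i, l i * ‖y i‖ ^ 2 - ‖∑ i, l i • y i‖ ^ 2) := by
  have h1 : ‖∑ i, l i • y i‖ ^ 2 = ∑ i, ∑ j, l i * l j * ⟪y i, y j⟫ := by
    rw [← real_inner_self_eq_norm_sq, sum_inner]
    refine Finset.sum_congr rfl fun i _ => ?_
    rw [inner_sum]
    refine Finset.sum_congr rfl fun j _ => ?_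
    rw [real_inner_smul_left, real_inner_smul_right]
    ring
  have h2 : ∀ i j, l i * l j * ‖y i - y j‖ ^ 2 =
      l j * (l i * ‖y i‖ ^ 2) - 2 * (l i * l j * ⟪y i, y j⟫) + l i * (l j * ‖y j‖ ^ 2) := by
    intro i j
    rw [norm_sub_sq_real]
    ring
  simp only [h2, Finset.sum_add_distrib, Finset.sum_sub_distrib, ← Finset.mul_sum,
    ← Finset.sum_mul, hl]
  rw [h1]
  ring

/-- The one-point extension property: a nonexpansive map on finitely many points extends to one
further point, with value in the convex hull of the given values. -/
theorem exists_mem_convexHull_forall_norm_sub_le {ι : Type*} [Fintype ι] [Nonempty ι]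
    (x : ι → E) (y : ι → G) (h : ∀ i j, ‖y i - y j‖ ≤ ‖x i - x j‖) (a : E) :
    ∃ b ∈ convexHull ℝ (range y), ∀ i, ‖b - y i‖ ≤ ‖a - x i‖ := by
  classical
  let c : ι → ℝ := fun i => ‖y i‖ ^ 2 - ‖a - x i‖ ^ 2
  -- The point b will be the barycentre of the y i whose weights maximize this function over the
  -- simplex.
  let f : (ι → ℝ) → ℝ := fun l => ∑ i, l i * c i - ‖∑ i, l i • y i‖ ^ 2
  have hf : Continuous f := by fun_prop
  obtain ⟨l, hl, hmax⟩ := (isCompact_stdSimplex ℝ ι).exists_isMaxOn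
    ⟨_, single_mem_stdSimplex ℝ (Classical.arbitrary ι)⟩ hf.continuousOn
  set b : G := ∑ i, l i • y i with hb
  -- The weighted variance depends only on pairwise distances, so that of y is at most that of `a -
  -- x i`, which is at most ∑ l i ‖a - x i‖².
  have hfl : f l ≤ 0 := by
    have e1 := sum_sum_mul_norm_sub_sq hl.2 y
    have e2 := sum_sum_mul_norm_sub_sq hl.2 fun i => a - x i
    have e3 : ∑ i, ∑ j, l i * l j * ‖y i - y j‖ ^ 2 ≤
        ∑ i, ∑ j, l i * l j * ‖(a - x i) - (a - x j)‖ ^ 2 := by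
      refine Finset.sum_le_sum fun i _ => Finset.sum_le_sum fun j _ => ?_
      refine mul_le_mul_of_nonneg_left ?_ (mul_nonneg (hl.1 i) (hl.1 j))
      rw [sub_sub_sub_cancel_left, norm_sub_rev (x j)]
      exact pow_le_pow_left₀ (norm_nonneg _) (h i j) 2
    have e4 : f l = ∑ i, l i * ‖y i‖ ^ 2 - ∑ i, l i * ‖a - x i‖ ^ 2 - ‖b‖ ^ 2 := by
      simp only [f, c, mul_sub, Finset.sum_sub_distrib, hb]
    have e5 := sq_nonneg ‖∑ i, l i • (a - x i)‖
    rw [e4]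
    linarith
  refine ⟨b, ?_, fun i => ?_⟩
  · exact (convex_convexHull ℝ _).sum_mem (fun i _ => hl.1 i) hl.2
      fun i _ => subset_convexHull ℝ _ (mem_range_self i)
  -- First variation at the maximizer towards the vertex i; letting t → 0 gives ‖b - y i‖² - ‖a - x
  -- i‖² ≤ f l ≤ 0.
  · have key : ∀ t ∈ Ioo (0 : ℝ) 1,
        c i - ∑ j, l j * c j - 2 * ⟪b, y i - b⟫ - t * ‖y i - b‖ ^ 2 ≤ 0 := by
      intro t ht
      have hmem : (1 - t) • l + t • Pi.single i (1 : ℝ) ∈ stdSimplex ℝ ι :=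
        convex_stdSimplex ℝ ι hl (single_mem_stdSimplex ℝ i) (by linarith [ht.2]) ht.1.le (by ring)
      have h1 : f ((1 - t) • l + t • Pi.single i (1 : ℝ)) ≤ f l := hmax hmem
      have h2 : ∑ j, ((1 - t) • l + t • Pi.single i (1 : ℝ) : ι → ℝ) j * c j =
          (1 - t) * ∑ j, l j * c j + t * c i := by
        simp [add_mul, Finset.sum_add_distrib, Finset.mul_sum, mul_assoc, Pi.single_apply]
      have h3 : ∑ j, ((1 - t) • l + t • Pi.single i (1 : ℝ) : ι → ℝ) j • y j = b + t • (y i - b) := by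
        simp [add_smul, Finset.sum_add_distrib, Pi.single_apply, mul_smul, ← Finset.smul_sum, ← hb]
        module
      simp only [f] at h1
      rw [h2, h3, ← hb, norm_add_sq_real, norm_smul, real_inner_smul_right, mul_pow,
        Real.norm_eq_abs, sq_abs] at h1
      have h4 : t * (c i - ∑ j, l j * c j - 2 * ⟪b, y i - b⟫ - t * ‖y i - b‖ ^ 2) ≤ 0 := by
        linarith
      exact nonpos_of_mul_nonpos_right h4 ht.1
    have hlim : c i - ∑ j, l j * c j - 2 * ⟪b, y i - b⟫ ≤ 0 := by
      have ht : Tendsto (fun t : ℝ => c i - ∑ j, l j * c j - 2 * ⟪b, y i - b⟫ - t * ‖y i - b‖ ^ 2)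
          (𝓝[>] 0) (𝓝 (c i - ∑ j, l j * c j - 2 * ⟪b, y i - b⟫ - 0 * ‖y i - b‖ ^ 2)) :=
        (Continuous.tendsto (by fun_prop) 0).mono_left nhdsWithin_le_nhds
      rw [zero_mul, sub_zero] at ht
      refine le_of_tendsto ht ?_
      filter_upwards [Ioo_mem_nhdsGT (zero_lt_one (α := ℝ))] with t ht
      exact key t ht
    refine (sq_le_sq₀ (norm_nonneg _) (norm_nonneg _)).1 ?_
    have h5 : ⟪b, y i - b⟫ = ⟪b, y i⟫ - ‖b‖ ^ 2 := by
      rw [inner_sub_right, real_inner_self_eq_norm_sq]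
    have h6 := norm_sub_sq_real b (y i)
    simp only [f, ← hb] at hfl
    simp only [c] at hlim hfl
    linarith

/-- A nonexpansive map on a finite set extends to any larger finite set, with values in the convex
hull of the given values. -/
theorem exists_extend_finset [DecidableEq E] (φ : E → G) (s : Finset E) (hs : s.Nonempty)
    (hφ : ∀ u ∈ s, ∀ v ∈ s, ‖φ u - φ v‖ ≤ ‖u - v‖) (t : Finset E) :
    ∃ g : E → G, (∀ u, g u ∈ convexHull ℝ (φ '' s)) ∧ (∀ u ∈ s, g u = φ u) ∧
      ∀ u ∈ s ∪ t, ∀ v ∈ s ∪ t, ‖g u - g v‖ ≤ ‖u - v‖ := by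
  induction t using Finset.induction_on with
  | empty =>
    obtain ⟨u₀, hu₀⟩ := hs
    refine ⟨fun u => if u ∈ s then φ u else φ u₀, fun u => ?_, fun u hu => if_pos hu, ?_⟩
    · by_cases hu : u ∈ s
      · simpa [hu] using subset_convexHull ℝ _ (mem_image_of_mem φ (Finset.mem_coe.2 hu))
      · simpa [hu] using subset_convexHull ℝ _ (mem_image_of_mem φ (Finset.mem_coe.2 hu₀))
    · intro u hu v hv
      rw [Finset.union_empty] at hu hv
      simpa [hu, hv] using hφ u hu v hv
  | insert a t _ ih =>
    obtain ⟨g, hg, hgs, hgt⟩ := ih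
    by_cases ha : a ∈ s ∪ t
    · refine ⟨g, hg, hgs, ?_⟩
      rwa [Finset.union_insert, Finset.insert_eq_of_mem ha]
    · have : Nonempty (s ∪ t : Finset E) := (hs.mono Finset.subset_union_left).to_subtype
      obtain ⟨b, hb, hab⟩ := exists_mem_convexHull_forall_norm_sub_le
        (fun i : (s ∪ t : Finset E) => (i : E)) (fun i => g i)
        (fun i j => hgt i i.2 j j.2) a
      have hb' : b ∈ convexHull ℝ (φ '' s) :=
        convexHull_min (range_subset_iff.2 fun i => hg _) (convex_convexHull ℝ _) hb
      refine ⟨Function.update g a b, fun u => ?_, fun u hu => ?_, ?_⟩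
      · by_cases hu : u = a
        · simpa [hu] using hb'
        · simpa [hu] using hg u
      · have : u ≠ a := fun h => ha (h ▸ Finset.mem_union_left _ hu)
        simpa [this] using hgs u hu
      · intro u hu v hv
        rw [Finset.union_insert, Finset.mem_insert] at hu hv
        by_cases hua : u = a <;> by_cases hva : v = a
        · simp [hua, hva]
        · simpa [hua, hva] using hab ⟨v, hv.resolve_left hva⟩
        · rw [norm_sub_rev, norm_sub_rev u]
          simpa [hua, hva] using hab ⟨u, hu.resolve_left hua⟩
        · simpa [hua, hva] using hgt u (hu.resolve_left hua) v (hv.resolve_left hva)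

/-- Kirszbraun's theorem for finite sets: a nonexpansive map from a finite subset of an inner
product space into an inner product space extends to a nonexpansive map on the whole space. -/
theorem exists_lipschitzWith_one_extend (φ : E → G) (s : Finset E)
    (hφ : ∀ u ∈ s, ∀ v ∈ s, ‖φ u - φ v‖ ≤ ‖u - v‖) :
    ∃ g : E → G, LipschitzWith 1 g ∧ ∀ u ∈ s, g u = φ u := by
  classical
  rcases s.eq_empty_or_nonempty with rfl | hs
  · exact ⟨fun _ => 0, LipschitzWith.const' 0, by simp⟩
  set K : Set G := convexHull ℝ (φ '' s)
  have hK : IsCompact K := (s.finite_toSet.image φ).isCompact_convexHull ℝ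
  -- Keeping all values in the hull of a finite set makes Tychonoff applicable whatever the
  -- dimension of G. Any finite family of the pairwise constraints is then met by
  -- `exists_extend_finset`.
  have hKE : IsCompact (univ.pi fun _ : E => K) := isCompact_univ_pi fun _ => hK
  let Z : E × E → Set (E → G) := fun p =>
    {g | ‖g p.1 - g p.2‖ ≤ ‖p.1 - p.2‖} ∩ {g | ∀ u ∈ s, g u = φ u}
  have hZ : ∀ p, IsClosed (Z p) := by
    intro p
    refine (isClosed_le (by fun_prop) continuous_const).inter ?_
    simp only [ofPred_forall]
    refine isClosed_iInter fun u => isClosed_iInter fun _ => ?_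
    exact isClosed_singleton.preimage (continuous_apply u)
  obtain ⟨g, -, hg⟩ := hKE.inter_iInter_nonempty Z hZ fun p => by
    obtain ⟨g, h1, h2, h3⟩ := exists_extend_finset φ s hs hφ
      (p.image Prod.fst ∪ p.image Prod.snd)
    refine ⟨g, fun u _ => h1 u, ?_⟩
    simp only [mem_iInter]
    intro q hq
    refine ⟨h3 _ ?_ _ ?_, h2⟩
    · exact Finset.mem_union_right _ (Finset.mem_union_left _ (Finset.mem_image_of_mem _ hq))
    · exact Finset.mem_union_right _ (Finset.mem_union_right _ (Finset.mem_image_of_mem _ hq))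
  rw [mem_iInter] at hg
  refine ⟨g, LipschitzWith.of_dist_le_mul fun u v => ?_, (hg (0, 0)).2⟩
  simpa [dist_eq_norm] using (hg (u, v)).1

end Kirszbraun

/-! ### Spectral projections and the spectral dichotomy on the attractor -/

section Spectral

variable {H : Type*} [NormedAddCommGroup H] [InnerProductSpace ℝ H]

/-- The span of the first `n` vectors of a basis. -/
def firstSpan (w : HilbertBasis ℕ ℝ H) (n : ℕ) : Submodule ℝ H :=
  Submodule.span ℝ (range fun i : Fin n => w i)

instance (w : HilbertBasis ℕ ℝ H) (n : ℕ) : FiniteDimensional ℝ (firstSpan w n) :=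
  FiniteDimensional.span_of_finite ℝ (finite_range _)

theorem finrank_firstSpan_le (w : HilbertBasis ℕ ℝ H) (n : ℕ) :
    Module.finrank ℝ (firstSpan w n) ≤ n := by
  exact (finrank_range_le_card _).trans (Fintype.card_fin n).le

theorem mem_firstSpan (w : HilbertBasis ℕ ℝ H) {n j : ℕ} (hj : j < n) : w j ∈ firstSpan w n :=
  Submodule.subset_span ⟨⟨j, hj⟩, rfl⟩

theorem mem_firstSpan_orthogonal (w : HilbertBasis ℕ ℝ H) {n j : ℕ} (hj : n ≤ j) :
    w j ∈ (firstSpan w n)ᗮ := by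
  rw [Submodule.mem_orthogonal]
  intro u hu
  induction hu using Submodule.span_induction with
  | mem x hx =>
    obtain ⟨i, rfl⟩ := hx
    exact w.orthonormal.2 (ne_of_lt (i.2.trans_le hj))
  | zero => exact inner_zero_left _
  | add x y _ _ hx hy => rw [inner_add_left, hx, hy, add_zero]
  | smul c x _ hx => rw [real_inner_smul_left, hx, mul_zero]

theorem inner_sub_starProjection_firstSpan (w : HilbertBasis ℕ ℝ H) (n j : ℕ) (z : H) :
    ⟪w j, z - (firstSpan w n).starProjection z⟫ = if j < n then 0 else ⟪w j, z⟫ := by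
  split_ifs with h
  · exact Submodule.inner_right_of_mem_orthogonal (mem_firstSpan w h)
      (Submodule.sub_starProjection_mem_orthogonal z)
  · rw [inner_sub_right, real_inner_comm ((firstSpan w n).starProjection z),
      Submodule.inner_right_of_mem_orthogonal (Submodule.starProjection_apply_mem _ z)
      (mem_firstSpan_orthogonal w (not_lt.1 h)), sub_zero]

theorem hasSum_inner_sq (w : HilbertBasis ℕ ℝ H) (z : H) :
    HasSum (fun j => ⟪w j, z⟫ ^ 2) (‖z‖ ^ 2) := by
  have h := w.hasSum_inner_mul_inner z z
  rw [real_inner_self_eq_norm_sq] at h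
  refine h.congr_fun ?_
  intro j
  rw [real_inner_comm, sq]

theorem norm_le_two_mul_norm_starProjection {U : Submodule ℝ H} [U.HasOrthogonalProjection] {z : H}
    (h : ‖z - U.starProjection z‖ ≤ ‖U.starProjection z‖) : ‖z‖ ≤ 2 * ‖U.starProjection z‖ := by
  have := norm_add_le (U.starProjection z) (z - U.starProjection z)
  rw [add_sub_cancel] at this
  linarith

theorem norm_starProjection_firstSpan_le_sum (w : HilbertBasis ℕ ℝ H) (n : ℕ) (z : H) :
    ‖(firstSpan w n).starProjection z‖ ≤ ∑ j ∈ Finset.range n, |⟪w j, z⟫| := by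
  set p := (firstSpan w n).starProjection z with hp
  have h1 : ∀ j, ⟪w j, p⟫ = if j < n then ⟪w j, z⟫ else 0 := by
    intro j
    have h := inner_sub_starProjection_firstSpan w n j z
    rw [inner_sub_right, ← hp] at h
    split_ifs at h ⊢ <;> linarith
  have h2 : HasSum (fun j => ⟪w j, p⟫ • w j) p := by
    simpa only [w.repr_apply_apply] using w.hasSum_repr p
  have h3 : HasSum (fun j => ⟪w j, p⟫ • w j) (∑ j ∈ Finset.range n, ⟪w j, p⟫ • w j) :=
    hasSum_sum_of_ne_finset_zero fun j hj => by
      rw [h1, if_neg (by simpa using hj), zero_smul]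
  rw [h2.unique h3]
  refine (norm_sum_le _ _).trans (Finset.sum_le_sum fun j hj => ?_)
  rw [norm_smul, w.orthonormal.1, mul_one, h1, if_pos (Finset.mem_range.1 hj), Real.norm_eq_abs]

/-- A vector whose tail is dominated by its first `n` modes has a large mode among them. -/
theorem exists_lt_norm_le_mul_abs_inner (w : HilbertBasis ℕ ℝ H) {n : ℕ} {z : H} (hz : z ≠ 0)
    (h : ‖z - (firstSpan w n).starProjection z‖ ≤ ‖(firstSpan w n).starProjection z‖) :
    ∃ k < n, ‖z‖ ≤ 2 * n * |⟪w k, z⟫| := by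
  -- If every mode among the first n were below ‖z‖/2n, the projection would have norm below ‖z‖/2,
  -- contradicting dominance.
  by_contra! hcon
  have h1 := norm_le_two_mul_norm_starProjection h
  have h2 := norm_starProjection_firstSpan_le_sum w n z
  have hz' := norm_pos_iff.2 hz
  rcases Nat.eq_zero_or_pos n with rfl | hn
  · simp at h2
    simp [h2] at h1
    exact hz h1
  · have h3 : ∑ j ∈ Finset.range n, |⟪w j, z⟫| < ∑ j ∈ Finset.range n, ‖z‖ / (2 * n) := by
      refine Finset.sum_lt_sum_of_nonempty (Finset.nonempty_range_iff.2 hn.ne') fun j hj => ?_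
      rw [lt_div_iff₀ (by positivity), mul_comm]
      exact hcon j (Finset.mem_range.1 hj)
    rw [Finset.sum_const, Finset.card_range, nsmul_eq_mul] at h3
    have h4 : (n : ℝ) * (‖z‖ / (2 * n)) = ‖z‖ / 2 := by
      field_simp
    linarith

variable [CompleteSpace H]

theorem inner_apply_eq_mul_inner {A : H →ₗ.[ℝ] H} (hA : IsPosSelfAdjointCompactInv A)
    {w : HilbertBasis ℕ ℝ H} {lam : ℕ → ℝ} (hw : IsEigenbasis A w lam) (j : ℕ) (z : A.domain) :
    ⟪w j, A z⟫ = lam j * ⟪w j, (z : H)⟫ := by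
  obtain ⟨h, hj⟩ := hw.eigen j
  have hsym := LinearPMap.adjoint_isFormalAdjoint hA.selfAdjoint.dense_domain
  rw [LinearPMap.isSelfAdjoint_def.1 hA.selfAdjoint] at hsym
  have := hsym ⟨w j, h⟩ z
  rw [← real_inner_smul_left, ← hj]
  exact this.symm

theorem lam_pos {A : H →ₗ.[ℝ] H} (hA : IsPosSelfAdjointCompactInv A)
    {w : HilbertBasis ℕ ℝ H} {lam : ℕ → ℝ} (hw : IsEigenbasis A w lam) (j : ℕ) : 0 < lam j := by
  obtain ⟨h, hj⟩ := hw.eigen j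
  have := hA.pos ⟨w j, h⟩ fun h0 => w.orthonormal.ne_zero j (congrArg Subtype.val h0)
  rw [hj] at this
  simpa [real_inner_smul_left, w.orthonormal.1] using this

/-- Only modes j ≥ n survive in the tail, and A multiplies each by at least `lam n`. With indices
from zero, `lam n` is λₙ₊₁, the least eigenvalue of the tail. -/
theorem lam_mul_norm_sub_starProjection_le {A : H →ₗ.[ℝ] H} (hA : IsPosSelfAdjointCompactInv A)
    {w : HilbertBasis ℕ ℝ H} {lam : ℕ → ℝ} (hw : IsEigenbasis A w lam) (n : ℕ) (z : A.domain) :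
    lam n * ‖(z : H) - (firstSpan w n).starProjection z‖ ≤ ‖A z‖ := by
  refine (sq_le_sq₀ (mul_nonneg (lam_pos hA hw n).le (norm_nonneg _)) (norm_nonneg _)).1 ?_
  rw [mul_pow]
  refine hasSum_le (fun j => ?_) ((hasSum_inner_sq w _).mul_left (lam n ^ 2))
    (hasSum_inner_sq w (A z))
  rw [inner_sub_starProjection_firstSpan, inner_apply_eq_mul_inner hA hw, mul_pow]
  split_ifs with h
  · simpa using by positivity
  · exact mul_le_mul_of_nonneg_right
      (pow_le_pow_left₀ (lam_pos hA hw n).le (hw.mono (not_lt.1 h)) 2) (sq_nonneg _)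

/-- If `A z` is bounded log-linearly in `z`, then either the first `n` modes of `z` dominate
its tail, or `z` is exponentially small in the `n`-th eigenvalue. -/
theorem norm_tail_le_or_norm_le_exp {A : H →ₗ.[ℝ] H} (hA : IsPosSelfAdjointCompactInv A)
    {w : HilbertBasis ℕ ℝ H} {lam : ℕ → ℝ} (hw : IsEigenbasis A w lam) {C M : ℝ} (hC : 0 < C)
    (n : ℕ) (z : A.domain) (hz : ‖A z‖ ≤ C * ‖(z : H)‖ * Real.log (M ^ 2 / ‖(z : H)‖ ^ 2)) :
    ‖(z : H) - (firstSpan w n).starProjection z‖ ≤ ‖(firstSpan w n).starProjection (z : H)‖ ∨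
      ‖(z : H)‖ ≤ |M| * Real.exp (-(lam n / (4 * C))) := by
  rw [or_iff_not_imp_left, not_le]
  intro h
  set q := ‖(z : H) - (firstSpan w n).starProjection z‖
  set p := ‖(firstSpan w n).starProjection (z : H)‖
  have hq : 0 < q := (norm_nonneg _).trans_lt h
  have hzq : ‖(z : H)‖ ≤ 2 * q := by
    have := norm_add_le ((firstSpan w n).starProjection (z : H))
      ((z : H) - (firstSpan w n).starProjection z)
    rw [add_sub_cancel] at this
    linarith
  have hz0 : 0 < ‖(z : H)‖ := by
    rw [norm_pos_iff]
    intro h0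
    simp [q, h0] at hq
  have hlam := lam_pos hA hw n
  have h1 : lam n * q ≤ C * ‖(z : H)‖ * Real.log (M ^ 2 / ‖(z : H)‖ ^ 2) :=
    (lam_mul_norm_sub_starProjection_le hA hw n z).trans hz
  set l := Real.log (M ^ 2 / ‖(z : H)‖ ^ 2) with hl
  have hlpos : 0 < l := by
    have : 0 < C * ‖(z : H)‖ * l := (mul_pos hlam hq).trans_le h1
    exact (mul_pos_iff_of_pos_left (mul_pos hC hz0)).1 this
  -- The tail norm q cancels because ‖z‖ ≤ 2q. As l is twice log(|M|/‖z‖), this is the origin of 4C.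
  have h2 : lam n ≤ 2 * C * l := by
    have : lam n * q ≤ (2 * C * l) * q := by
      refine h1.trans ?_
      nlinarith [mul_le_mul_of_nonneg_left hzq (mul_pos hC hlpos).le]
    exact le_of_mul_le_mul_right this hq
  have hM : M ≠ 0 := by
    rintro rfl
    simp [hl] at hlpos
  have h3 : Real.log ‖(z : H)‖ ≤ Real.log |M| - lam n / (4 * C) := by
    have e : l = 2 * Real.log |M| - 2 * Real.log ‖(z : H)‖ := by
      rw [hl, Real.log_div (by positivity) (by positivity), Real.log_pow, Real.log_pow, Real.log_abs]
      norm_num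
    have : lam n / (4 * C) ≤ l / 2 := by
      rw [div_le_div_iff₀ (by positivity) (by norm_num)]
      linarith
    linarith
  calc ‖(z : H)‖ = Real.exp (Real.log ‖(z : H)‖) := (Real.exp_log hz0).symm
    _ ≤ Real.exp (Real.log |M| - lam n / (4 * C)) := Real.exp_le_exp.2 h3
    _ = |M| * Real.exp (-(lam n / (4 * C))) := by
      rw [sub_eq_add_neg, Real.exp_add, Real.exp_log (abs_pos.2 hM)]

end Spectral

/-! ### Lipschitz deviation zero -/

section Deviation

/-- A maximal separated set is a cover. It is finite because the packing number at ε is bounded by a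
covering number at ε/2. -/
theorem exists_finset_separated_cover {E : Type*} [NormedAddCommGroup E] {X : Set E} (hX : IsCompact X) {ε : ℝ}
    (hε : 0 < ε) :
    ∃ s : Finset E, (s : Set E) ⊆ X ∧ (∀ u ∈ s, ∀ v ∈ s, u ≠ v → ε < ‖u - v‖) ∧
      ∀ x ∈ X, ∃ y ∈ s, dist x y ≤ ε := by
  lift ε to ℝ≥0 using hε.le
  have hε' : ε / 2 ≠ 0 := (half_pos (NNReal.coe_pos.1 hε)).ne'
  obtain ⟨t, -, htf, ht⟩ := Metric.exists_finite_isCover_of_isCompact hε' hX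
  have hp : Metric.packingNumber ε X ≠ ⊤ := by
    have h1 := Metric.packingNumber_two_mul_le_externalCoveringNumber (ε / 2) X
    rw [mul_div_cancel₀ _ two_ne_zero] at h1
    exact (h1.trans ht.externalCoveringNumber_le_encard).trans_lt htf.encard_lt_top |>.ne
  have hfin : (Metric.maximalSeparatedSet ε X).Finite := by
    rw [← encard_ne_top_iff, Metric.encard_maximalSeparatedSet hp]
    exact hp
  refine ⟨hfin.toFinset, ?_, fun u hu v hv huv => ?_, fun x hx => ?_⟩
  · simpa using Metric.maximalSeparatedSet_subset
  · have := Metric.isSeparated_maximalSeparatedSet (ε := ε) (A := X) (hfin.mem_toFinset.1 hu)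
      (hfin.mem_toFinset.1 hv) huv
    change (ε : ℝ≥0∞) < edist u v at this
    rw [edist_nndist] at this
    rw [← dist_eq_norm]
    exact_mod_cast this
  · obtain ⟨y, hy, hxy⟩ := Metric.isCover_maximalSeparatedSet hp hx
    refine ⟨y, hfin.mem_toFinset.2 hy, ?_⟩
    change edist x y ≤ ε at hxy
    rw [edist_nndist] at hxy
    exact_mod_cast hxy

variable {H : Type*} [NormedAddCommGroup H] [InnerProductSpace ℝ H]

/-- Differences of points of `X` that are at least `ε` apart are dominated by a subpolynomial number
of modes. -/
def HasDominantModes (w : HilbertBasis ℕ ℝ H) (X : Set H) : Prop :=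
  ∀ η : ℝ, 0 < η → ∀ᶠ ε : ℝ in 𝓝[>] 0, ∃ n : ℕ, (n : ℝ) ≤ ε ^ (-η) ∧ ∀ u ∈ X, ∀ v ∈ X, ε ≤ ‖u - v‖ →
    ‖(u - v) - (firstSpan w n).starProjection (u - v)‖ ≤ ‖(firstSpan w n).starProjection (u - v)‖

theorem tendsto_neg_log_nhdsGT_zero : Tendsto (fun ε : ℝ => -Real.log ε) (𝓝[>] 0) atTop :=
  tendsto_neg_atBot_atTop.comp Real.tendsto_log_nhdsGT_zero

/-- With n = ⌊ε^(-η)⌋, log n is comparable to η log(1/ε), so the hypothesis makes `lam n` exceed any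
multiple of log(1/ε). -/
theorem eventually_mul_exp_neg_lt {lam : ℕ → ℝ} (hpos : ∀ n, 0 < lam n)
    (hlam : Tendsto (fun n : ℕ => Real.log n / lam n) atTop (𝓝 0)) {c M η : ℝ} (hc : 0 < c)
    (hη : 0 < η) :
    ∀ᶠ ε : ℝ in 𝓝[>] 0, M * Real.exp (-(lam ⌊ε ^ (-η)⌋₊ / c)) < ε := by
  have hκ : 0 < η / (4 * c) := by positivity
  have hfloor : Tendsto (fun ε : ℝ => ⌊ε ^ (-η)⌋₊) (𝓝[>] 0) atTop :=
    tendsto_nat_floor_atTop.comp (tendsto_rpow_neg_nhdsGT_zero (neg_lt_zero.2 hη))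
  filter_upwards [hfloor.eventually (hlam.eventually_lt_const hκ), hfloor.eventually_ge_atTop 1,
    tendsto_neg_log_nhdsGT_zero.eventually_ge_atTop (2 * Real.log 2 / η),
    tendsto_neg_log_nhdsGT_zero.eventually_gt_atTop (Real.log (|M| + 1)),
    self_mem_nhdsWithin] with ε h1 h2 h3 h4 h5
  have hε : 0 < ε := h5
  set n := ⌊ε ^ (-η)⌋₊
  set L := -Real.log ε with hL
  have h2' : (1 : ℝ) ≤ n := by exact_mod_cast h2
  have hn : ε ^ (-η) / 2 ≤ n := by
    have := Nat.lt_floor_add_one (ε ^ (-η))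
    change ε ^ (-η) < (n : ℝ) + 1 at this
    linarith
  have hlogn : η * L - Real.log 2 ≤ Real.log n := by
    have := Real.log_le_log (by positivity) hn
    rw [Real.log_div (by positivity) two_ne_zero, Real.log_rpow hε] at this
    linarith
  have h3' : 2 * Real.log 2 ≤ L * η := (div_le_iff₀ hη).1 h3
  -- One copy of L produces ε, the other absorbs the factor M; this fixes the threshold η/4c.
  have hlam' : 2 * L ≤ lam n / c := by
    rw [div_lt_iff₀ (hpos n)] at h1
    have h6 : η / 2 * L ≤ η / (4 * c) * lam n := by linarith
    have h7 : η / (4 * c) * lam n = η / 4 * (lam n / c) := by field_simp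
    rw [h7] at h6
    have : η / 4 * (2 * L) ≤ η / 4 * (lam n / c) := by linarith
    exact le_of_mul_le_mul_left this (by positivity)
  have hM : 0 < |M| + 1 := by positivity
  calc M * Real.exp (-(lam n / c)) ≤ |M| * Real.exp (-(lam n / c)) :=
        mul_le_mul_of_nonneg_right (le_abs_self M) (Real.exp_pos _).le
    _ < (|M| + 1) * Real.exp (-(lam n / c)) :=
        mul_lt_mul_of_pos_right (lt_add_one _) (Real.exp_pos _)
    _ = Real.exp (Real.log (|M| + 1) + -(lam n / c)) := by rw [Real.exp_add, Real.exp_log hM]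
    _ ≤ Real.exp (Real.log ε) := Real.exp_le_exp.2 (by linarith)
    _ = ε := Real.exp_log hε

/-- A finite set whose differences have tail orthogonal to `U` dominated by their projection to `U`
lies on the graph of a nonexpansive map over `U`. -/
theorem exists_lipschitzWith_subset_graphOver (U : Submodule ℝ H) [U.HasOrthogonalProjection]
    (s : Finset H) (hs : ∀ u ∈ s, ∀ v ∈ s,
      ‖(u - v) - U.starProjection (u - v)‖ ≤ ‖U.starProjection (u - v)‖) :
    ∃ φ : U → Uᗮ, LipschitzWith 1 φ ∧ (s : Set H) ⊆ graphOver U φ := by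
  classical
  let P : H → U := fun z => ⟨U.starProjection z, U.starProjection_apply_mem z⟩
  let Q : H → Uᗮ := fun z => ⟨z - U.starProjection z, U.sub_starProjection_mem_orthogonal z⟩
  have hPQ : ∀ u ∈ s, ∀ v ∈ s, ‖Q u - Q v‖ ≤ ‖P u - P v‖ := by
    intro u hu v hv
    have h := hs u hu v hv
    rw [map_sub] at h
    change ‖(u - U.starProjection u) - (v - U.starProjection v)‖ ≤
      ‖U.starProjection u - U.starProjection v‖
    rwa [sub_sub_sub_comm]
  -- The choice of preimage under P does not matter: by `hPQ`, equal P values in s force equal Q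
  -- values.
  have hinv : ∀ u ∈ s, Function.invFunOn P s (P u) ∈ s ∧ P (Function.invFunOn P s (P u)) = P u :=
    fun u hu => ⟨Function.invFunOn_mem ⟨u, hu, rfl⟩, Function.invFunOn_eq ⟨u, hu, rfl⟩⟩
  obtain ⟨φ, hφ, hφs⟩ := exists_lipschitzWith_one_extend (fun p => Q (Function.invFunOn P s p))
    (s.image P) (by
      simp only [Finset.forall_mem_image]
      intro u hu v hv
      refine (hPQ _ (hinv u hu).1 _ (hinv v hv).1).trans ?_
      rw [(hinv u hu).2, (hinv v hv).2])
  refine ⟨φ, hφ, fun u hu => ⟨P u, ?_⟩⟩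
  have hQ : φ (P u) = Q u := by
    rw [hφs _ (Finset.mem_image_of_mem P hu), ← sub_eq_zero, ← norm_le_zero_iff]
    refine (hPQ _ (hinv u hu).1 u hu).trans ?_
    rw [(hinv u hu).2, sub_self, norm_zero]
  simp [hQ, P, Q]

/-- Distinct points of an ε/2-separated net satisfy the hypothesis, so the net lies on a graph over
the first n modes. Its mesh ε/2 makes the supremum strictly less than ε. -/
theorem lipDelta_one_le {w : HilbertBasis ℕ ℝ H} {X : Set H} (hX : IsCompact X) {ε : ℝ}
    (hε : 0 < ε) {n : ℕ} (hn : ∀ u ∈ X, ∀ v ∈ X, ε / 2 ≤ ‖u - v‖ →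
      ‖(u - v) - (firstSpan w n).starProjection (u - v)‖ ≤
        ‖(firstSpan w n).starProjection (u - v)‖) : lipDelta 1 X ε ≤ n := by
  obtain ⟨s, hsX, hsep, hcov⟩ := exists_finset_separated_cover hX (half_pos hε)
  obtain ⟨φ, hφ, hsφ⟩ := exists_lipschitzWith_subset_graphOver (firstSpan w n) s fun u hu v hv => by
    rcases eq_or_ne u v with rfl | huv
    · simp
    · exact hn u (hsX hu) v (hsX hv) (hsep u hu v hv huv).le
  refine le_trans (Nat.sInf_le (m := Module.finrank ℝ (firstSpan w n)) ?_)
    (finrank_firstSpan_le w n)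
  refine ⟨firstSpan w n, inferInstance, rfl, φ, hφ, ?_⟩
  refine lt_of_le_of_lt (iSup₂_le fun x hx => ?_)
    ((ENNReal.ofReal_lt_ofReal_iff hε).2 (half_lt_self hε))
  obtain ⟨y, hy, hxy⟩ := hcov x hx
  refine (Metric.infEDist_le_edist_of_mem (hsφ hy)).trans ?_
  rw [edist_dist]
  exact ENNReal.ofReal_le_ofReal hxy

theorem HasDominantModes.lipDev_one_eq_zero {w : HilbertBasis ℕ ℝ H} {X : Set H}
    (h : HasDominantModes w X) (hX : IsCompact X) : lipDev 1 X = 0 := by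
  refine le_antisymm (ENNReal.le_of_forall_pos_le_add fun η hη _ => ?_) zero_le
  rw [zero_add]
  refine limsup_le_of_le (by isBoundedDefault) ?_
  -- Half of η is spent on the mode count; the other half absorbs the passage from ε to ε/2.
  have hη' : (0 : ℝ) < η / 2 := by positivity
  have hhalf : Tendsto (fun ε : ℝ => ε / 2) (𝓝[>] 0) (𝓝[>] 0) := by
    refine tendsto_nhdsWithin_iff.2 ⟨?_, ?_⟩
    · exact (by simpa using (tendsto_id (α := ℝ) (x := 𝓝 0)).div_const 2 :
        Tendsto (fun ε : ℝ => ε / 2) (𝓝 0) (𝓝 0)).mono_left nhdsWithin_le_nhds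
    · filter_upwards [self_mem_nhdsWithin] with ε hε using half_pos (mem_Ioi.1 hε)
  filter_upwards [hhalf.eventually (h _ hη'), self_mem_nhdsWithin,
    tendsto_neg_log_nhdsGT_zero.eventually_ge_atTop 1] with ε hε hε0 hε1
  obtain ⟨n, hn, hdom⟩ := hε
  have hε0 : 0 < ε := hε0
  have hle := lipDelta_one_le hX hε0 hdom
  rw [← ENNReal.ofReal_coe_nnreal]
  refine ENNReal.ofReal_le_ofReal ?_
  rw [div_le_iff₀ (by linarith)]
  rcases Nat.eq_zero_or_pos (lipDelta 1 X ε) with h0 | h0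
  · rw [h0, Nat.cast_zero, Real.log_zero]
    exact mul_nonneg η.2 (by linarith)
  · have h1 : (lipDelta 1 X ε : ℝ) ≤ (ε / 2) ^ (-(η / 2 : ℝ)) := le_trans (by exact_mod_cast hle) hn
    have h2 := Real.log_le_log (by exact_mod_cast h0) h1
    rw [Real.log_rpow (half_pos hε0), Real.log_div hε0.ne' two_ne_zero] at h2
    have h3 : Real.log 2 ≤ 1 := by linarith [Real.log_two_lt_d9]
    have h4 : η / 2 * Real.log 2 ≤ η / 2 * -Real.log ε :=
      mul_le_mul_of_nonneg_left (h3.trans hε1) hη'.le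
    linarith

/-- Membership in the domain puts the coefficients in ℓ², so the defining sum really converges to
the vector with these coordinates. -/
theorem inner_fracPow {w : HilbertBasis ℕ ℝ H} {lam : ℕ → ℝ} {α : ℝ} {u : H}
    (hu : u ∈ fracDomain w lam α) (j : ℕ) : ⟪w j, fracPow w lam α u⟫ = lam j ^ α * ⟪w j, u⟫ := by
  have hmem : Memℓp (fun j => lam j ^ α * ⟪w j, u⟫) 2 := by
    refine memℓp_gen ?_
    simpa [fracDomain, mul_pow] using hu
  let f : lp (fun _ : ℕ => ℝ) 2 := ⟨_, hmem⟩
  have h : fracPow w lam α u = w.repr.symm f := (w.hasSum_repr_symm f).tsum_eq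
  rw [h, ← w.repr_apply_apply, LinearIsometryEquiv.apply_symm_apply]

/-- The power multiplies distances by at least `lam 0 ^ α`, so its inverse on the compact image is
Lipschitz. -/
theorem isCompact_of_isCompact_image_fracPow {w : HilbertBasis ℕ ℝ H} {lam : ℕ → ℝ}
    (hpos : ∀ j, 0 < lam j) (hmono : Monotone lam) {α : ℝ} (hα : 0 ≤ α) {X : Set H}
    (hX : X ⊆ fracDomain w lam α) (hc : IsCompact (fracPow w lam α '' X)) : IsCompact X := by
  have hlow : ∀ u ∈ X, ∀ v ∈ X,
      lam 0 ^ α * ‖u - v‖ ≤ ‖fracPow w lam α u - fracPow w lam α v‖ := by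
    intro u hu v hv
    have h0 := Real.rpow_pos_of_pos (hpos 0) α
    refine (sq_le_sq₀ (mul_nonneg h0.le (norm_nonneg _)) (norm_nonneg _)).1 ?_
    rw [mul_pow]
    refine hasSum_le (fun j => ?_) ((hasSum_inner_sq w _).mul_left ((lam 0 ^ α) ^ 2))
      (hasSum_inner_sq w _)
    rw [inner_sub_right _ (fracPow w lam α u), inner_fracPow (hX hu), inner_fracPow (hX hv),
      ← mul_sub, ← inner_sub_right, mul_pow]
    exact mul_le_mul_of_nonneg_right (pow_le_pow_left₀ h0.le
      (Real.rpow_le_rpow (hpos 0).le (hmono (Nat.zero_le j)) hα) 2) (sq_nonneg _)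
  have h0 := Real.rpow_pos_of_pos (hpos 0) α
  have hinj : InjOn (fracPow w lam α) X := by
    intro u hu v hv huv
    have h := hlow u hu v hv
    rw [huv, sub_self, norm_zero] at h
    exact sub_eq_zero.1 (norm_le_zero_iff.1 (nonpos_of_mul_nonpos_right h h0))
  have hleft := hinj.leftInvOn_invFunOn
  rw [← hleft.image_image]
  refine hc.image_of_continuousOn (LipschitzOnWith.continuousOn
    (K := ((lam 0 ^ α)⁻¹).toNNReal) (LipschitzOnWith.of_dist_le_mul ?_))
  rintro _ ⟨u, hu, rfl⟩ _ ⟨v, hv, rfl⟩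
  rw [hleft hu, hleft hv, Real.coe_toNNReal _ (inv_pos.2 h0).le, dist_eq_norm, dist_eq_norm,
    inv_mul_eq_div, le_div_iff₀ h0, mul_comm]
  exact hlow u hu v hv

variable [CompleteSpace H]

theorem hasDominantModes_of_log {A : H →ₗ.[ℝ] H} (hA : IsPosSelfAdjointCompactInv A)
    {w : HilbertBasis ℕ ℝ H} {lam : ℕ → ℝ} (hw : IsEigenbasis A w lam)
    (hlam : Tendsto (fun n : ℕ => Real.log n / lam n) atTop (𝓝 0)) {X : Set H}
    (hX : X ⊆ A.domain) {C M : ℝ} (hC : 0 < C)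
    (hlog : ∀ u v : A.domain, (u : H) ∈ X → (v : H) ∈ X → u ≠ v →
      ‖A (u - v)‖ ≤ C * ‖(u - v : H)‖ * Real.log (M ^ 2 / ‖(u - v : H)‖ ^ 2)) :
    HasDominantModes w X := by
  intro η hη
  filter_upwards [eventually_mul_exp_neg_lt (M := |M|) (lam_pos hA hw) hlam
    (mul_pos four_pos hC) hη, self_mem_nhdsWithin] with ε hε hε0
  have hε0 : 0 < ε := hε0
  refine ⟨_, Nat.floor_le (Real.rpow_nonneg hε0.le _), fun u hu v hv huv => ?_⟩
  have hne : (⟨u, hX hu⟩ : A.domain) ≠ ⟨v, hX hv⟩ := by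
    intro h
    have : u = v := congrArg Subtype.val h
    rw [this, sub_self, norm_zero] at huv
    exact huv.not_gt hε0
  refine (norm_tail_le_or_norm_le_exp hA hw hC _ (⟨u, hX hu⟩ - ⟨v, hX hv⟩ : A.domain)
    (hlog ⟨u, hX hu⟩ ⟨v, hX hv⟩ hu hv hne)).resolve_right fun h => ?_
  exact (huv.trans h).not_gt hε

end Deviation

/-! ### A random linear map and its small-ball estimate -/

section RandomMap

/-- Resampling one coordinate preserves a product measure. -/
theorem infinitePi_prod_map_update {ι : Type*} [DecidableEq ι] {X : ι → Type*}
    [∀ i, MeasurableSpace (X i)] (μ : ∀ i, Measure (X i)) [∀ i, IsProbabilityMeasure (μ i)] (k : ι) :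
    ((Measure.infinitePi μ).prod (μ k)).map (fun p => Function.update p.1 k p.2) =
      Measure.infinitePi μ := by
  have hmeas : Measurable fun p : (∀ i, X i) × X k => Function.update p.1 k p.2 :=
    measurable_update'
  refine Measure.eq_infinitePi μ fun s t ht => ?_
  rw [Measure.map_apply hmeas (.pi s.countable_toSet fun i _ => ht i)]
  have hpre : (fun p : (∀ i, X i) × X k => Function.update p.1 k p.2) ⁻¹' (s : Set ι).pi t =
      ((s.erase k : Finset ι) : Set ι).pi t ×ˢ (if k ∈ s then t k else univ) := by
    ext p
    simp only [mem_preimage, Set.mem_pi, Finset.mem_coe, mem_prod, Finset.mem_erase]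
    constructor
    · intro h
      refine ⟨fun i hi => by simpa [hi.1] using h i hi.2, ?_⟩
      split_ifs with hk
      · simpa using h k hk
      · trivial
    · rintro ⟨h1, h2⟩ i hi
      by_cases hik : i = k
      · subst hik
        simpa [hi] using h2
      · simpa [hik] using h1 i ⟨hik, hi⟩
  rw [hpre, Measure.prod_prod, Measure.infinitePi_pi _ fun i _ => ht i]
  split_ifs with hk
  · exact Finset.prod_erase_mul s (fun i => μ i (t i)) hk
  · rw [Finset.erase_eq_of_notMem hk, measure_univ, mul_one]

/-- Fubini after resampling: a bound for coordinate k that is uniform in the remaining coordinates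
bounds the whole probability. -/
theorem infinitePi_le_of_forall_update {ι : Type*} [DecidableEq ι] {X : ι → Type*}
    [∀ i, MeasurableSpace (X i)] (μ : ∀ i, Measure (X i)) [∀ i, IsProbabilityMeasure (μ i)] (k : ι)
    {E : Set (∀ i, X i)} (hE : MeasurableSet E) {c : ℝ≥0∞}
    (h : ∀ ω, μ k {y | Function.update ω k y ∈ E} ≤ c) : Measure.infinitePi μ E ≤ c := by
  have hmeas : Measurable fun p : (∀ i, X i) × X k => Function.update p.1 k p.2 :=
    measurable_update'
  rw [← infinitePi_prod_map_update μ k, Measure.map_apply hmeas hE,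
    Measure.prod_apply (hmeas hE)]
  refine (lintegral_mono h).trans ?_
  rw [lintegral_const, measure_univ, mul_one]

theorem volume_unitInterval_slab_le {β b δ : ℝ} (hb : b ≠ 0) :
    volume {t : unitInterval | |β + b * t| ≤ δ} ≤ ENNReal.ofReal (2 * δ / |b|) := by
  rw [unitInterval.volume_apply]
  refine (measure_mono (t := Metric.closedBall (-β / b) (δ / |b|)) ?_).trans ?_
  · rintro _ ⟨t, ht, rfl⟩
    have ht : |β + b * t| ≤ δ := ht
    rw [Metric.mem_closedBall, Real.dist_eq, le_div_iff₀ (abs_pos.2 hb), ← abs_mul]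
    have h : ((t : ℝ) - -β / b) * b = β + b * t := by
      field_simp
      ring
    rwa [h]
  · rw [Real.volume_closedBall, mul_div_assoc]

theorem volume_cube_slab_le {N : ℕ} {β : Fin N → ℝ} {b δ : ℝ} (hb : b ≠ 0) :
    volume {y : Fin N → unitInterval | ∀ i, |β i + b * y i| ≤ δ} ≤
      ENNReal.ofReal (2 * δ / |b|) ^ N := by
  have : {y : Fin N → unitInterval | ∀ i, |β i + b * y i| ≤ δ} =
      univ.pi fun i => {t : unitInterval | |β i + b * t| ≤ δ} := by
    ext y
    simp
  rw [this, volume_pi_pi]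
  refine (Finset.prod_le_prod' fun i _ => volume_unitInterval_slab_le hb).trans ?_
  simp

/-- A point of the unit cube as a Euclidean vector. -/
def cubeVec {N : ℕ} (y : Fin N → unitInterval) : EuclideanSpace ℝ (Fin N) :=
  WithLp.toLp 2 fun i => (y i : ℝ)

theorem continuous_cubeVec {N : ℕ} : Continuous (cubeVec (N := N)) := by
  unfold cubeVec
  fun_prop

theorem norm_cubeVec_le {N : ℕ} (y : Fin N → unitInterval) : ‖cubeVec y‖ ≤ √N := by
  rw [EuclideanSpace.norm_eq]
  refine Real.sqrt_le_sqrt ((Finset.sum_le_card_nsmul _ _ 1 fun i _ => ?_).trans ?_)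
  · rw [sq_le_one_iff₀ (norm_nonneg _), Real.norm_eq_abs, abs_le]
    exact ⟨by linarith [(y i).2.1, show (cubeVec y) i = y i from rfl], (y i).2.2⟩
  · simp

variable {H : Type*} [NormedAddCommGroup H] [InnerProductSpace ℝ H]

/-- One mode of the random linear map. -/
def modeMap (w : HilbertBasis ℕ ℝ H) {N : ℕ} (k : ℕ) (y : Fin N → unitInterval) :
    H →L[ℝ] EuclideanSpace ℝ (Fin N) :=
  (((k : ℝ) + 1) ^ 2)⁻¹ • (innerSL ℝ (w k)).smulRight (cubeVec y)

/-- The random linear map `z ↦ ∑ₖ (k + 1)⁻² ⟪wₖ, z⟫ ωₖ`, where the coefficients `ωₖ` range over the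
unit cube. -/
def randomMap (w : HilbertBasis ℕ ℝ H) {N : ℕ} (ω : ℕ → Fin N → unitInterval) :
    H →L[ℝ] EuclideanSpace ℝ (Fin N) :=
  ∑' k, modeMap w k (ω k)

theorem modeMap_apply (w : HilbertBasis ℕ ℝ H) {N : ℕ} (k : ℕ) (y : Fin N → unitInterval) (z : H)
    (i : Fin N) : modeMap w k y z i = (((k : ℝ) + 1) ^ 2)⁻¹ * ⟪w k, z⟫ * y i := by
  simp [modeMap, cubeVec, mul_assoc]

theorem norm_modeMap_le (w : HilbertBasis ℕ ℝ H) {N : ℕ} (k : ℕ) (y : Fin N → unitInterval) :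
    ‖modeMap w k y‖ ≤ (((k : ℝ) + 1) ^ 2)⁻¹ * √N := by
  rw [modeMap, norm_smul, ContinuousLinearMap.norm_smulRight_apply, innerSL_apply_norm,
    w.orthonormal.1, one_mul, Real.norm_of_nonneg (by positivity)]
  exact mul_le_mul_of_nonneg_left (norm_cubeVec_le y) (by positivity)

theorem summable_modeMap_bound (N : ℕ) : Summable fun k : ℕ => (((k : ℝ) + 1) ^ 2)⁻¹ * √N := by
  have h := (summable_nat_add_iff 1).2 (Real.summable_nat_pow_inv.2 (one_lt_two : 1 < 2))
  simpa using h.mul_right √N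

theorem hasSum_randomMap (w : HilbertBasis ℕ ℝ H) {N : ℕ} (ω : ℕ → Fin N → unitInterval) :
    HasSum (fun k => modeMap w k (ω k)) (randomMap w ω) :=
  (Summable.of_norm_bounded (summable_modeMap_bound N) fun k => norm_modeMap_le w k _).hasSum

/-- The weights (k+1)⁻² are summable, so the series converges uniformly. Continuity on a compact
product of cubes later yields a compactly supported law. -/
theorem continuous_randomMap (w : HilbertBasis ℕ ℝ H) {N : ℕ} :
    Continuous (randomMap w (N := N)) := by
  refine continuous_tsum (fun k => ?_) (summable_modeMap_bound N) fun k ω => norm_modeMap_le w k _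
  have h1 : Continuous fun v : EuclideanSpace ℝ (Fin N) => (innerSL ℝ (w k)).smulRight v :=
    (ContinuousLinearMap.smulRightL ℝ H (EuclideanSpace ℝ (Fin N)) (innerSL ℝ (w k))).continuous
  have h2 : Continuous fun ω : ℕ → Fin N → unitInterval => cubeVec (ω k) :=
    continuous_cubeVec.comp (continuous_apply k)
  exact (h1.comp h2).const_smul ((((k : ℝ) + 1) ^ 2)⁻¹)

theorem randomMap_update (w : HilbertBasis ℕ ℝ H) {N : ℕ} (ω : ℕ → Fin N → unitInterval) (k : ℕ)
    (y : Fin N → unitInterval) :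
    randomMap w (Function.update ω k y) = modeMap w k y - modeMap w k (ω k) + randomMap w ω := by
  have h : (fun j => modeMap w j (Function.update ω k y j)) =
      Function.update (fun j => modeMap w j (ω j)) k (modeMap w k y) :=
    funext fun j => Function.apply_update (fun j => modeMap w j) ω k y j
  refine (hasSum_randomMap w _).unique ?_
  rw [h]
  exact (hasSum_randomMap w ω).update k (modeMap w k y)

/-- The law of the coefficients of the random linear map: independent and uniform on the cube. -/
def coeffMeasure (N : ℕ) : Measure (ℕ → Fin N → unitInterval) :=
  Measure.infinitePi fun _ => volume

instance (N : ℕ) : IsProbabilityMeasure (coeffMeasure N) :=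
  inferInstanceAs (IsProbabilityMeasure (Measure.infinitePi _))

/-- With every coefficient but the k-th frozen, each coordinate of the image of z is affine in its
own uniform variable with slope (k+1)⁻²⟪wₖ, z⟫; the translation v only changes the offset. -/
theorem coeffMeasure_norm_le (w : HilbertBasis ℕ ℝ H) {N : ℕ}
    (v : H →L[ℝ] EuclideanSpace ℝ (Fin N)) {z : H} {k : ℕ} (hk : ⟪w k, z⟫ ≠ 0) (δ : ℝ) :
    coeffMeasure N {ω | ‖(randomMap w ω + v) z‖ ≤ δ} ≤
      ENNReal.ofReal (2 * δ * (k + 1) ^ 2 / |⟪w k, z⟫|) ^ N := by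
  have hclosed : IsClosed {ω : ℕ → Fin N → unitInterval | ‖(randomMap w ω + v) z‖ ≤ δ} := by
    refine isClosed_le (Continuous.norm ?_) continuous_const
    exact ((continuous_randomMap w).add continuous_const).clm_apply continuous_const
  refine infinitePi_le_of_forall_update _ k hclosed.measurableSet fun ω => ?_
  have hk1 : (0 : ℝ) < ((k : ℝ) + 1) ^ 2 := by positivity
  set b := (((k : ℝ) + 1) ^ 2)⁻¹ * ⟪w k, z⟫ with hb
  have hb0 : b ≠ 0 := mul_ne_zero (inv_ne_zero hk1.ne') hk
  have hbd : 2 * δ * (k + 1) ^ 2 / |⟪w k, z⟫| = 2 * δ / |b| := by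
    rw [hb, abs_mul, abs_of_pos (inv_pos.2 hk1)]
    field_simp
  rw [hbd]
  refine (measure_mono fun y hy => ?_).trans (volume_cube_slab_le
    (β := fun i => (randomMap w ω + v - modeMap w k (ω k)) z i) hb0)
  intro i
  have hy : ‖(randomMap w (Function.update ω k y) + v) z‖ ≤ δ := hy
  refine le_trans (le_of_eq ?_) ((PiLp.norm_apply_le _ i).trans hy)
  rw [Real.norm_eq_abs, randomMap_update]
  congr 1
  simp only [add_apply, sub_apply, PiLp.add_apply,
    PiLp.sub_apply, modeMap_apply w k y, ← hb]
  ring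

/-- The small-ball estimate for a vector dominated by its first `n` modes. -/
theorem coeffMeasure_norm_le_of_dominant (w : HilbertBasis ℕ ℝ H) {N : ℕ}
    (v : H →L[ℝ] EuclideanSpace ℝ (Fin N)) {z : H} {n : ℕ} {ρ δ : ℝ} (hρ : 0 < ρ) (hδ : 0 ≤ δ)
    (hz : ρ ≤ ‖z‖)
    (h : ‖z - (firstSpan w n).starProjection z‖ ≤ ‖(firstSpan w n).starProjection z‖) :
    coeffMeasure N {ω | ‖(randomMap w ω + v) z‖ ≤ δ} ≤
      ENNReal.ofReal (4 * δ * n ^ 3 / ρ) ^ N := by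
  obtain ⟨k, hkn, hk⟩ := exists_lt_norm_le_mul_abs_inner w
    (norm_pos_iff.1 (hρ.trans_le hz)) h
  have hk0 : 0 < |⟪w k, z⟫| := by
    by_contra hcon
    have : |⟪w k, z⟫| = 0 := le_antisymm (not_lt.1 hcon) (abs_nonneg _)
    rw [this, mul_zero] at hk
    linarith
  refine (coeffMeasure_norm_le w v (abs_pos.1 hk0) δ).trans ?_
  gcongr ?_ ^ N
  refine ENNReal.ofReal_le_ofReal ?_
  rw [div_le_div_iff₀ hk0 hρ]
  -- The weight costs n² and the size of the chosen mode another 2n, hence the n³.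
  have h1 : ((k : ℝ) + 1) ^ 2 ≤ (n : ℝ) ^ 2 := by
    have : (k : ℝ) + 1 ≤ n := by exact_mod_cast hkn
    gcongr
  calc 2 * δ * (k + 1) ^ 2 * ρ ≤ 2 * δ * (n : ℝ) ^ 2 * (2 * n * |⟪w k, z⟫|) := by
        gcongr
        exact hz.trans hk
    _ = 4 * δ * n ^ 3 * |⟪w k, z⟫| := by ring

end RandomMap

/-! ### Prevalence of Hölder embeddings -/

section Prevalence

theorem exists_finset_cover_card_eq {E : Type*} [NormedAddCommGroup E] {X : Set E} (hX : IsCompact X) {ε : ℝ} (hε : 0 < ε) :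
    ∃ s : Finset E, (s : Set E) ⊆ X ∧ (∀ x ∈ X, ∃ y ∈ s, ‖x - y‖ ≤ ε) ∧
      s.card = (Metric.coveringNumber ε.toNNReal X).toNat := by
  obtain ⟨t, htX, htf, ht⟩ :=
    Metric.exists_finite_isCover_of_isCompact (Real.toNNReal_pos.2 hε).ne' hX
  have hc : Metric.coveringNumber ε.toNNReal X ≠ ⊤ :=
    ((ht.coveringNumber_le_encard htX).trans_lt htf.encard_lt_top).ne
  obtain ⟨s, hsX, hsf, hs, hcard⟩ := Metric.exists_set_encard_eq_coveringNumber hc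
  refine ⟨hsf.toFinset, by simpa using hsX, fun x hx => ?_, ?_⟩
  · obtain ⟨y, hy, hxy⟩ := hs hx
    refine ⟨y, hsf.mem_toFinset.2 hy, ?_⟩
    change edist x y ≤ ε.toNNReal at hxy
    rw [edist_nndist, ENNReal.coe_le_coe, ← NNReal.coe_le_coe, coe_nndist,
      Real.coe_toNNReal _ hε.le] at hxy
    rwa [← dist_eq_norm]
  · rw [← hcard, ← ncard_eq_toFinset_card s hsf]
    rfl

/-- A compact set of box-counting dimension `d` has covers of cardinality at most `ε ^ (-d')` for
every `d' > d`. -/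
theorem eventually_exists_finset_cover {E : Type*} [NormedAddCommGroup E] {X : Set E} (hX : IsCompact X)
    {d : ℝ≥0} (hd : boxDim X = d) {d' : ℝ} (hdd' : (d : ℝ) < d') :
    ∀ᶠ ε : ℝ in 𝓝[>] 0, ∃ s : Finset E, (s : Set E) ⊆ X ∧ (∀ x ∈ X, ∃ y ∈ s, ‖x - y‖ ≤ ε) ∧
      (s.card : ℝ) ≤ ε ^ (-d') := by
  have hlt : boxDim X < ENNReal.ofReal d' := by
    rw [hd, ← ENNReal.ofReal_coe_nnreal]
    exact (ENNReal.ofReal_lt_ofReal_iff (d.2.trans_lt hdd')).2 hdd'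
  filter_upwards [eventually_lt_of_limsup_lt hlt (by isBoundedDefault), self_mem_nhdsWithin,
    tendsto_neg_log_nhdsGT_zero.eventually_gt_atTop 0] with ε hε hε0 hL
  have hε0 : 0 < ε := hε0
  obtain ⟨s, hsX, hs, hcard⟩ := exists_finset_cover_card_eq hX hε0
  refine ⟨s, hsX, hs, ?_⟩
  rcases Nat.eq_zero_or_pos s.card with h0 | h0
  · rw [h0, Nat.cast_zero]
    exact Real.rpow_nonneg hε0.le _
  · rw [ENNReal.ofReal_lt_ofReal_iff (d.2.trans_lt hdd'), ← hcard, div_lt_iff₀ hL] at hε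
    rw [← Real.log_le_log_iff (by exact_mod_cast h0) (Real.rpow_pos_of_pos hε0 _),
      Real.log_rpow hε0]
    linarith

variable {H : Type*} [NormedAddCommGroup H] [InnerProductSpace ℝ H]

/-- If at every small dyadic scale `ρ` the map `L` moves points at distance at least `ρ ^ θ` by more
than `ρ`, then the inverse of `L` is Hölder continuous with exponent `θ`. -/
theorem mem_holderEmbeddings_of_forall_scale {X : Set H} {D : ℝ}
    (hD : ∀ x ∈ X, ∀ y ∈ X, ‖x - y‖ ≤ D) {N : ℕ} {θ : ℝ} (hθ : 0 < θ)
    {L : H →L[ℝ] EuclideanSpace ℝ (Fin N)} {J : ℕ}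
    (hL : ∀ j ≥ J, ∀ x ∈ X, ∀ y ∈ X, ((1 / 2 : ℝ) ^ j) ^ θ ≤ ‖x - y‖ →
      (1 / 2 : ℝ) ^ j < ‖L (x - y)‖) : L ∈ holderEmbeddings X N θ := by
  set ρ : ℝ := (1 / 2) ^ J with hρ
  have hρ0 : 0 < ρ := by positivity
  have hρθ : 0 < ρ ^ θ := Real.rpow_pos_of_pos hρ0 θ
  have h2 : (0 : ℝ) < 2 ^ θ := Real.rpow_pos_of_pos two_pos θ
  have key : ∀ x ∈ X, ∀ y ∈ X, ‖x - y‖ ≤ (|D| / ρ ^ θ + 2 ^ θ) * ‖L x - L y‖ ^ θ := by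
    intro x hx y hy
    rw [← map_sub]
    have hLθ : 0 ≤ ‖L (x - y)‖ ^ θ := Real.rpow_nonneg (norm_nonneg _) θ
    have hDρ : 0 ≤ |D| / ρ ^ θ := by positivity
    rcases (norm_nonneg (x - y)).eq_or_lt with h0 | h0
    · rw [← h0]
      positivity
    rw [add_mul]
    -- Pairs far apart are handled by the diameter bound at scale J, nearby pairs by the dyadic
    -- scale just below ‖x - y‖^(1/θ).
    rcases le_or_gt (ρ ^ θ) ‖x - y‖ with hr | hr
    · have h1 : ρ ^ θ ≤ ‖L (x - y)‖ ^ θ :=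
        Real.rpow_le_rpow hρ0.le (hL J le_rfl x hx y hy hr).le hθ.le
      have h3 : |D| ≤ |D| / ρ ^ θ * ‖L (x - y)‖ ^ θ := by
        rw [div_mul_eq_mul_div, le_div_iff₀ hρθ]
        exact mul_le_mul_of_nonneg_left h1 (abs_nonneg D)
      have h4 := (hD x hx y hy).trans (le_abs_self D)
      have h5 := mul_nonneg h2.le hLθ
      linarith
    · set r := ‖x - y‖ ^ θ⁻¹ with hrdef
      have hr0 : 0 < r := Real.rpow_pos_of_pos h0 _
      have hrθ : r ^ θ = ‖x - y‖ := Real.rpow_inv_rpow h0.le hθ.ne'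
      have hrρ : r < ρ := by
        rw [← hrθ] at hr
        exact (Real.rpow_lt_rpow_iff hr0.le hρ0.le hθ).1 hr
      have hρ1 : ρ ≤ 1 := pow_le_one₀ (by norm_num) (by norm_num)
      obtain ⟨j, hj1, hj2⟩ := exists_nat_pow_near_of_lt_one hr0 (hrρ.le.trans hρ1)
        (by norm_num : (0 : ℝ) < 1 / 2) (by norm_num)
      have hJj : J ≤ j + 1 :=
        ((pow_lt_pow_iff_right_of_lt_one₀ (by norm_num : (0 : ℝ) < 1 / 2) (by norm_num)).1
          (hj1.trans hrρ)).le
      have h6 : ((1 / 2 : ℝ) ^ (j + 1)) ^ θ ≤ ‖x - y‖ := by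
        rw [← hrθ]
        exact Real.rpow_le_rpow (by positivity) hj1.le hθ.le
      have h7 := (hL (j + 1) hJj x hx y hy h6).le
      have h8 : r ≤ 2 * ‖L (x - y)‖ := by
        rw [pow_succ] at h7
        linarith
      have h9 : ‖x - y‖ ≤ 2 ^ θ * ‖L (x - y)‖ ^ θ := by
        rw [← hrθ, ← Real.mul_rpow two_pos.le (norm_nonneg _)]
        exact Real.rpow_le_rpow hr0.le h8 hθ.le
      have h10 := mul_nonneg hDρ hLθ
      linarith
  refine ⟨fun x hx y hy hxy => ?_, _, by positivity, key⟩
  have h := key x hx y hy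
  rw [hxy, sub_self, norm_zero, Real.zero_rpow hθ.ne', mul_zero] at h
  exact sub_eq_zero.1 (norm_le_zero_iff.1 h)

/-- Each fixed Hölder constant gives a closed condition, and integer constants suffice. Injectivity
comes for free since 0^θ = 0. -/
theorem measurableSet_holderEmbeddings (X : Set H) (N : ℕ) {θ : ℝ} (hθ : 0 < θ) :
    MeasurableSet (holderEmbeddings X N θ) := by
  have h : holderEmbeddings X N θ =
      ⋃ n : ℕ, ⋂ x ∈ X, ⋂ y ∈ X, {L : H →L[ℝ] EuclideanSpace ℝ (Fin N) |
        ‖x - y‖ ≤ ((n : ℝ) + 1) * ‖L x - L y‖ ^ θ} := by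
    ext L
    simp only [mem_iUnion, mem_iInter]
    constructor
    · rintro ⟨-, C, hC, h⟩
      obtain ⟨n, hn⟩ := exists_nat_ge C
      refine ⟨n, fun x hx y hy => (h x hx y hy).trans ?_⟩
      exact mul_le_mul_of_nonneg_right (by linarith) (Real.rpow_nonneg (norm_nonneg _) _)
    · rintro ⟨n, h⟩
      have h : ∀ x ∈ X, ∀ y ∈ X, ‖x - y‖ ≤ ((n : ℝ) + 1) * ‖L x - L y‖ ^ θ := h
      refine ⟨fun x hx y hy hxy => ?_, n + 1, by positivity, h⟩
      have h := h x hx y hy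
      rw [hxy, sub_self, norm_zero, Real.zero_rpow hθ.ne', mul_zero] at h
      exact sub_eq_zero.1 (norm_le_zero_iff.1 h)
  rw [h]
  refine MeasurableSet.iUnion fun n => IsClosed.measurableSet ?_
  refine isClosed_biInter fun x _ => isClosed_biInter fun y _ => ?_
  refine isClosed_le continuous_const (continuous_const.mul ?_)
  refine Continuous.rpow_const (Continuous.norm ?_) fun _ => Or.inr hθ.le
  exact (continuous_id.clm_apply continuous_const).sub (continuous_id.clm_apply continuous_const)

/-- At scale `ρ`, the random map brings points of `X` at distance at least `ρ ^ θ` within `ρ` of each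
other only with probability at most a positive power of `ρ`. -/
theorem exists_eventually_coeffMeasure_le {w : HilbertBasis ℕ ℝ H} {X : Set H} (hX : IsCompact X)
    (hdom : HasDominantModes w X) {d : ℝ≥0} (hd : boxDim X = d) {N : ℕ} {θ : ℝ} (hθ0 : 0 < θ)
    (hθ1 : θ < 1) (hN : 2 * (d : ℝ) < N * (1 - θ)) (v : H →L[ℝ] EuclideanSpace ℝ (Fin N)) :
    ∃ σ : ℝ, 0 < σ ∧ ∃ K : ℝ, ∀ᶠ ρ : ℝ in 𝓝[>] 0,
      coeffMeasure N {ω | ∃ x ∈ X, ∃ y ∈ X, ρ ^ θ ≤ ‖x - y‖ ∧ ‖(randomMap w ω + v) (x - y)‖ ≤ ρ} ≤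
        ENNReal.ofReal (K * ρ ^ σ) := by
  obtain ⟨R, hR⟩ : ∃ R, ∀ ω, ‖randomMap w ω + v‖ ≤ R := by
    obtain ⟨R, hR⟩ := (isCompact_range ((continuous_randomMap w (N := N)).add
      (continuous_const (y := v)))).isBounded.exists_norm_le
    exact ⟨R, fun ω => hR _ (mem_range_self ω)⟩
  have hR0 : 0 ≤ R := (norm_nonneg _).trans (hR 0)
  -- The losses in the exponent are η(3Nθ + 2); this η keeps them below half of the gap N(1-θ) - 2d.
  have hη : 0 < (N * (1 - θ) - 2 * d) / (2 * (3 * N + 2)) := div_pos (by linarith) (by positivity)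
  set η := (N * (1 - θ) - 2 * d) / (2 * (3 * N + 2)) with hηdef
  have hσ : 0 < N * (1 - θ * (1 + 3 * η)) - 2 * (d + η) := by
    have h1 : η * (2 * (3 * N + 2)) = N * (1 - θ) - 2 * d := div_mul_cancel₀ _ (by positivity)
    have h2 : N * η * θ ≤ N * η * 1 := mul_le_mul_of_nonneg_left hθ1.le (by positivity)
    nlinarith
  set σ := N * (1 - θ * (1 + 3 * η)) - 2 * (d + η) with hσdef
  refine ⟨σ, hσ, (4 * (1 + 2 * R) * 2 ^ (1 + 3 * η)) ^ N, ?_⟩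
  have hscale : Tendsto (fun ρ : ℝ => ρ ^ θ / 2) (𝓝[>] 0) (𝓝[>] 0) := by
    refine tendsto_nhdsWithin_iff.2 ⟨?_, ?_⟩
    · have h : Tendsto (fun ρ : ℝ => ρ ^ θ / 2) (𝓝 0) (𝓝 (0 ^ θ / 2)) :=
        ((Real.continuous_rpow_const hθ0.le).div_const 2).tendsto 0
      rw [Real.zero_rpow hθ0.ne', zero_div] at h
      exact h.mono_left nhdsWithin_le_nhds
    · filter_upwards [self_mem_nhdsWithin] with ρ hρ
      exact half_pos (Real.rpow_pos_of_pos hρ θ)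
  -- Moving both points to the net changes their difference by at most 2ρ, so net pairs stay at
  -- least ρ^θ/2 apart; this needs θ < 1.
  have hsmall : ∀ᶠ ρ : ℝ in 𝓝[>] 0, 2 * ρ ≤ ρ ^ θ / 2 := by
    filter_upwards [(tendsto_rpow_neg_nhdsGT_zero (sub_neg.2 hθ1)).eventually_ge_atTop 4,
      self_mem_nhdsWithin] with ρ h1 h2
    have hρ : 0 < ρ := h2
    rw [Real.rpow_sub_one hρ.ne', le_div_iff₀ hρ] at h1
    linarith
  filter_upwards [eventually_exists_finset_cover hX hd (lt_add_of_pos_right (d : ℝ) hη),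
    hscale.eventually (hdom η hη), hsmall, self_mem_nhdsWithin] with ρ hcov hmodes hsm hρ
  have hρ : 0 < ρ := hρ
  obtain ⟨s, hsX, hs, hcard⟩ := hcov
  obtain ⟨n, hn, hmodes⟩ := hmodes
  have hε : 0 < ρ ^ θ / 2 := half_pos (Real.rpow_pos_of_pos hρ θ)
  set ε := ρ ^ θ / 2 with hεdef
  -- The image bound ρ, plus operator norm R times the displacement 2ρ.
  set δ := (1 + 2 * R) * ρ with hδdef
  have hδ : 0 ≤ δ := by positivity
  set T := (s ×ˢ s).filter fun p => ε ≤ ‖p.1 - p.2‖ with hT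
  have hsub : {ω | ∃ x ∈ X, ∃ y ∈ X, ρ ^ θ ≤ ‖x - y‖ ∧ ‖(randomMap w ω + v) (x - y)‖ ≤ ρ} ⊆
      ⋃ p ∈ T, {ω : ℕ → Fin N → unitInterval | ‖(randomMap w ω + v) (p.1 - p.2)‖ ≤ δ} := by
    rintro ω ⟨x, hx, y, hy, hxy, hL⟩
    obtain ⟨a, ha, hxa⟩ := hs x hx
    obtain ⟨b, hb, hyb⟩ := hs y hy
    have h1 : ‖(a - b) - (x - y)‖ ≤ 2 * ρ := by
      have e : (a - b) - (x - y) = (y - b) - (x - a) := by abel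
      rw [e]
      exact (norm_sub_le _ _).trans (by linarith)
    have h2 : ε ≤ ‖a - b‖ := by
      have := norm_sub_norm_le (x - y) (a - b)
      rw [norm_sub_rev (x - y)] at this
      linarith
    simp only [mem_iUnion]
    refine ⟨(a, b), Finset.mem_filter.2 ⟨Finset.mk_mem_product ha hb, h2⟩, ?_⟩
    change ‖(randomMap w ω + v) (a - b)‖ ≤ δ
    have e : a - b = (x - y) + ((a - b) - (x - y)) := by abel
    rw [e, map_add]
    refine (norm_add_le _ _).trans ?_
    have h3 := ((randomMap w ω + v).le_opNorm ((a - b) - (x - y))).trans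
      (mul_le_mul (hR ω) h1 (norm_nonneg _) hR0)
    linarith
  have hbound : ∀ p ∈ T, coeffMeasure N {ω | ‖(randomMap w ω + v) (p.1 - p.2)‖ ≤ δ} ≤
      ENNReal.ofReal ((4 * δ * n ^ 3 / ε) ^ N) := by
    intro p hp
    obtain ⟨hp1, hp2⟩ := Finset.mem_filter.1 hp
    obtain ⟨ha, hb⟩ := Finset.mem_product.1 hp1
    rw [ENNReal.ofReal_pow (by positivity)]
    exact coeffMeasure_norm_le_of_dominant w v hε hδ hp2 (hmodes _ (hsX ha) _ (hsX hb) hp2)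
  have hTcard : (T.card : ℝ) ≤ ρ ^ (-(2 * (d + η))) := by
    have h1 : (T.card : ℝ) ≤ s.card * s.card := by
      exact_mod_cast (Finset.card_filter_le _ _).trans (Finset.card_product s s).le
    refine h1.trans ((mul_le_mul hcard hcard (Nat.cast_nonneg _)
      (Real.rpow_nonneg hρ.le _)).trans ?_)
    rw [← Real.rpow_add hρ]
    exact le_of_eq (by ring_nf)
  have hq : 4 * δ * n ^ 3 / ε ≤
      4 * (1 + 2 * R) * 2 ^ (1 + 3 * η) * ρ ^ (1 - θ * (1 + 3 * η)) := by
    have h1 : (n : ℝ) ^ 3 / ε ≤ ε ^ (-(1 + 3 * η)) := by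
      have h2 : (n : ℝ) ^ 3 ≤ ε ^ (-(3 * η)) := by
        refine (pow_le_pow_left₀ (Nat.cast_nonneg n) hn 3).trans (le_of_eq ?_)
        rw [← Real.rpow_natCast, ← Real.rpow_mul hε.le]
        congr 1
        push_cast
        ring
      have h5 : -(1 + 3 * η) = -(3 * η) - 1 := by ring
      rw [h5, Real.rpow_sub_one hε.ne']
      exact div_le_div_of_nonneg_right h2 hε.le
    have h3 : ε ^ (-(1 + 3 * η)) = 2 ^ (1 + 3 * η) * ρ ^ (-(θ * (1 + 3 * η))) := by
      rw [hεdef, Real.div_rpow (Real.rpow_nonneg hρ.le _) two_pos.le, ← Real.rpow_mul hρ.le,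
        Real.rpow_neg two_pos.le, div_inv_eq_mul, mul_comm, mul_neg]
    have h4 : ρ ^ (1 - θ * (1 + 3 * η)) = ρ * ρ ^ (-(θ * (1 + 3 * η))) := by
      rw [sub_eq_add_neg, Real.rpow_add hρ, Real.rpow_one]
    rw [mul_div_assoc, h4]
    refine (mul_le_mul_of_nonneg_left (h1.trans_eq h3) (by positivity)).trans (le_of_eq ?_)
    rw [hδdef]
    ring
  refine (measure_mono hsub).trans ((measure_biUnion_finset_le _ _).trans
    ((Finset.sum_le_card_nsmul _ _ _ hbound).trans ?_))
  rw [← ENNReal.ofReal_nsmul, nsmul_eq_mul]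
  refine ENNReal.ofReal_le_ofReal ?_
  have hρN : (ρ ^ (1 - θ * (1 + 3 * η))) ^ N = ρ ^ (N * (1 - θ * (1 + 3 * η))) := by
    rw [← Real.rpow_natCast, ← Real.rpow_mul hρ.le, mul_comm]
  calc (T.card : ℝ) * (4 * δ * n ^ 3 / ε) ^ N
      ≤ ρ ^ (-(2 * (d + η))) *
        (4 * (1 + 2 * R) * 2 ^ (1 + 3 * η) * ρ ^ (1 - θ * (1 + 3 * η))) ^ N := by
        gcongr
    _ = (4 * (1 + 2 * R) * 2 ^ (1 + 3 * η)) ^ N * ρ ^ σ := by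
        rw [mul_pow _ (ρ ^ _), hρN, hσdef, sub_eq_neg_add ((N : ℝ) * _), Real.rpow_add hρ]
        ring

/-- Borel–Cantelli: the failure probabilities at ρ = 2⁻ʲ are bounded by a geometric series, so
almost surely only finitely many scales fail. -/
theorem ae_randomMap_add_mem_holderEmbeddings {w : HilbertBasis ℕ ℝ H} {X : Set H}
    (hX : IsCompact X) (hdom : HasDominantModes w X) {d : ℝ≥0} (hd : boxDim X = d) {N : ℕ} {θ : ℝ}
    (hθ0 : 0 < θ) (hθ1 : θ < 1) (hN : 2 * (d : ℝ) < N * (1 - θ))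
    (v : H →L[ℝ] EuclideanSpace ℝ (Fin N)) :
    ∀ᵐ ω ∂coeffMeasure N, randomMap w ω + v ∈ holderEmbeddings X N θ := by
  obtain ⟨σ, hσ, K, hK⟩ := exists_eventually_coeffMeasure_le hX hdom hd hθ0 hθ1 hN v
  have hdyad : Tendsto (fun j : ℕ => (1 / 2 : ℝ) ^ j) atTop (𝓝[>] 0) :=
    tendsto_nhdsWithin_iff.2 ⟨tendsto_pow_atTop_nhds_zero_of_lt_one (by norm_num) (by norm_num),
      Eventually.of_forall fun j => mem_Ioi.2 (by positivity)⟩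
  obtain ⟨J, hJ⟩ := eventually_atTop.1 (hdyad.eventually hK)
  have hsum : Summable fun j : ℕ => K * ((1 / 2 : ℝ) ^ (j + J)) ^ σ := by
    have h1 : ∀ j : ℕ, ((1 / 2 : ℝ) ^ (j + J)) ^ σ = ((1 / 2 : ℝ) ^ σ) ^ (j + J) := fun j => by
      rw [← Real.rpow_natCast, ← Real.rpow_natCast, ← Real.rpow_mul (by norm_num),
        ← Real.rpow_mul (by norm_num), mul_comm]
    simp only [h1]
    refine Summable.mul_left K ((summable_nat_add_iff J).2
      (summable_geometric_of_lt_one (r := (1 / 2 : ℝ) ^ σ) (by positivity) ?_))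
    exact Real.rpow_lt_one (by norm_num) (by norm_num) hσ
  have hae := ae_eventually_notMem (μ := coeffMeasure N) (s := fun j : ℕ =>
    {ω | ∃ x ∈ X, ∃ y ∈ X, ((1 / 2 : ℝ) ^ (j + J)) ^ θ ≤ ‖x - y‖ ∧
      ‖(randomMap w ω + v) (x - y)‖ ≤ (1 / 2 : ℝ) ^ (j + J)})
    (ne_top_of_le_ne_top hsum.tsum_ofReal_ne_top
      (ENNReal.tsum_le_tsum fun j => hJ (j + J) (Nat.le_add_left J j)))
  obtain ⟨D, hD⟩ := Metric.isBounded_iff.1 hX.isBounded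
  filter_upwards [hae] with ω hω
  obtain ⟨J', hJ'⟩ := eventually_atTop.1 hω
  refine mem_holderEmbeddings_of_forall_scale (D := D) (J := J' + J)
    (fun x hx y hy => by rw [← dist_eq_norm]; exact hD hx hy) hθ0 fun j hj x hx y hy hxy => ?_
  have h := hJ' (j - J) (by omega)
  rw [Nat.sub_add_cancel (by omega)] at h
  by_contra hcon
  exact h ⟨x, hx, y, hy, hxy, not_lt.1 hcon⟩

/-- The set is itself Borel, and the law of the random map is a single probe measure serving all
translations. -/
theorem isPrevalent_holderEmbeddings {w : HilbertBasis ℕ ℝ H} {X : Set H}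
    (hX : IsCompact X) (hdom : HasDominantModes w X) {d : ℝ≥0} (hd : boxDim X = d) {N : ℕ} {θ : ℝ}
    (hθ0 : 0 < θ) (hθ1 : θ < 1) (hN : 2 * (d : ℝ) < N * (1 - θ)) :
    IsPrevalent (holderEmbeddings X N θ) := by
  have hc := continuous_randomMap w (N := N)
  have hB := measurableSet_holderEmbeddings X N hθ0
  refine ⟨_, Subset.rfl, hB, (coeffMeasure N).map (randomMap w),
    Measure.isProbabilityMeasure_map hc.measurable.aemeasurable,
    ⟨range (randomMap w), isCompact_range hc, ?_⟩, fun v => ?_⟩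
  · rw [Measure.map_apply hc.measurable (isCompact_range hc).isClosed.measurableSet.compl]
    convert measure_empty (μ := coeffMeasure N)
    ext ω
    simp
  · rw [ae_map_iff hc.measurable.aemeasurable
      ((continuous_add_const v).measurable hB)]
    exact ae_randomMap_add_mem_holderEmbeddings hX hdom hd hθ0 hθ1 hN v

end Prevalence

end

theorem mainTheorem3 {H : Type*} [NormedAddCommGroup H] [InnerProductSpace ℝ H] [CompleteSpace H]
    (A : H →ₗ.[ℝ] H) (hA : IsPosSelfAdjointCompactInv A)
    (w : HilbertBasis ℕ ℝ H) (lam : ℕ → ℝ) (hw : IsEigenbasis A w lam)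
    (hlam : Tendsto (fun n : ℕ => Real.log n / lam n) atTop (𝓝 0))
    (F : H → H) (hF : LocLipOn w lam (1 / 2) F)
    (S : ℝ → H → H) (hS : IsSolutionSemigroup w lam (1 / 2) F S)
    (𝒜 : Set H) (h𝒜 : IsGlobalAttractor w lam (1 / 2) S 𝒜)
    (hdom : 𝒜 ⊆ A.domain) (C M₁ : ℝ) (hC : 0 < C)
    (hlog : ∀ u v : A.domain, (u : H) ∈ 𝒜 → (v : H) ∈ 𝒜 → u ≠ v →
      ‖A (u - v)‖ ≤ C * ‖(u - v : H)‖ * Real.log (M₁ ^ 2 / ‖(u - v : H)‖ ^ 2)) :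
    lipDev 1 𝒜 = 0 ∧
    ∀ d : ℝ≥0, boxDim 𝒜 = d →
      (∀ N : ℕ, 2 * (d : ℝ) < N → ∀ θ : ℝ, 0 < θ → θ < 1 - 2 * d / N →
        IsPrevalent (holderEmbeddings 𝒜 N θ)) ∧
      (∀ θ : ℝ, 0 < θ → θ < 1 → ∃ N₀ : ℕ, ∀ N ≥ N₀,
        IsPrevalent (holderEmbeddings 𝒜 N θ)) := by
  have hpos := lam_pos hA hw
  have hcomp : IsCompact 𝒜 := isCompact_of_isCompact_image_fracPow hpos hw.mono (by norm_num)
    h𝒜.subset h𝒜.compact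
  have hdom' : HasDominantModes w 𝒜 := hasDominantModes_of_log hA hw hlam hdom hC hlog
  -- Both embedding claims reduce to 2d < N(1-θ): one reads it as a bound on θ, the other as a bound
  -- on N.
  have key : ∀ d : ℝ≥0, boxDim 𝒜 = d → ∀ N : ℕ, ∀ θ : ℝ, 0 < θ → θ < 1 →
      2 * (d : ℝ) < N * (1 - θ) → IsPrevalent (holderEmbeddings 𝒜 N θ) :=
    fun d hd N θ h0 h1 hN => isPrevalent_holderEmbeddings hcomp hdom' hd h0 h1 hN
  refine ⟨hdom'.lipDev_one_eq_zero hcomp, fun d hd => ⟨fun N hN θ h0 hθ => ?_, fun θ h0 h1 => ?_⟩⟩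
  · have hN0 : (0 : ℝ) < N := (mul_nonneg two_pos.le d.2).trans_lt hN
    have hq : 0 ≤ 2 * (d : ℝ) / N := by positivity
    refine key d hd N θ h0 (by linarith) ?_
    have : 2 * (d : ℝ) / N < 1 - θ := by linarith
    rw [div_lt_iff₀ hN0] at this
    linarith
  · obtain ⟨N₀, hN₀⟩ := exists_nat_gt (2 * (d : ℝ) / (1 - θ))
    refine ⟨N₀, fun N hN => key d hd N θ h0 h1 ?_⟩
    rw [← div_lt_iff₀ (by linarith)]
    exact hN₀.trans_le (by exact_mod_cast hN)
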